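/- For complex $q$ with $|q|<1$ and $s\in\mathbb{C}$ let $\mathcal{L}_q(s)=\sum_{n=1}^{\infty}\frac{n^s q^n}{1-q^n}$ be the Lambert series, and let $B_m$ denote the $m$th Bernoulli number. For integers $k\ge 1$ and $0\le j\le k$ put $$a_k=\frac{2^{4k}\left(3^{4k+1}+1\right)}{2^{4k+1}-(-1)^k2^{2k}+1},\qquad b_k=\frac{3^{4k+1}-1}{2}-(-1)^k2^{2k}-a_k\,\frac{2^{4k+1}-(-1)^k2^{2k}-1}{2^{4k+1}},$$ $$c_{jk}=3^{2j-1}\sum_{n=-1}^{1}(1+in)^{4k+1-2j}-3^{4k+1-2j}\sum_{n=-1}^{1}(1+in)^{2j-1}-a_k\left[\frac{1+(1+i)^{4k+1-2j}}{2^{4k+1-2j}}-\frac{1+(1+i)^{2j-1}}{2^{2j-1}}\right].$$ Then for every integer $k\ge 1$ the denominator of $a_k$ and the number $b_k$ are nonzero, the three Lambert series below converge absolutely, and $$\zeta(4k+1)=\frac{(2\pi)^{4k+1}}{2b_k}\sum_{j=0}^{k}\frac{(-1)^{j+1}c_{jk}\,B_{2j}\,B_{4k+2-2j}}{(2j)!\,(4k+2-2j)!}+\frac{(-1)^k2^{2k+1}}{b_k}\,\mathcal{L}_{-e^{-3\pi}}(-4k-1)-\frac{a_k}{2^{4k-1}b_k}\,\mathcal{L}_{e^{-4\pi}}(-4k-1)+\frac{2^{2k}}{2^{2k-1}b_k}\,\mathcal{L}_{e^{-6\pi}}(-4k-1).$$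 -/

import Mathlib

noncomputable section

namespace LambertZeta

open Complex

/-- The summand of the Lambert series at index `n`. -/
def lambertTerm (q s : ℂ) (n : ℕ) : ℂ :=
  (n : ℂ) ^ s * q ^ n / (1 - q ^ n)

/-- The Lambert series `∑_{n ≥ 1} n ^ s q ^ n / (1 - q ^ n)`, where `|q| < 1`. -/
def lambertL (q s : ℂ) : ℂ :=
  ∑' n : ℕ, lambertTerm q s (n + 1)

/-- The denominator of `a k`. -/
def aDen (k : ℕ) : ℝ :=
  2 ^ (4 * k + 1) - (-1) ^ k * 2 ^ (2 * k) + 1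

def a (k : ℕ) : ℝ :=
  2 ^ (4 * k) * (3 ^ (4 * k + 1) + 1) / aDen k

def b (k : ℕ) : ℝ :=
  (3 ^ (4 * k + 1) - 1) / 2 - (-1) ^ k * 2 ^ (2 * k)
    - a k * ((2 ^ (4 * k + 1) - (-1) ^ k * 2 ^ (2 * k) - 1) / 2 ^ (4 * k + 1))

/-- All exponents are integers; `2 * j - 1` equals `-1` at `j = 0`. -/
def c (j k : ℕ) : ℂ :=
  (3 : ℂ) ^ (2 * (j : ℤ) - 1)
      * ∑ n ∈ Finset.Icc (-1 : ℤ) 1, (1 + I * (n : ℂ)) ^ (4 * (k : ℤ) + 1 - 2 * (j : ℤ))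
    - (3 : ℂ) ^ (4 * (k : ℤ) + 1 - 2 * (j : ℤ))
      * ∑ n ∈ Finset.Icc (-1 : ℤ) 1, (1 + I * (n : ℂ)) ^ (2 * (j : ℤ) - 1)
    - (a k : ℂ) *
      ((1 + (1 + I) ^ (4 * (k : ℤ) + 1 - 2 * (j : ℤ)))
          / (2 : ℂ) ^ (4 * (k : ℤ) + 1 - 2 * (j : ℤ))
        - (1 + (1 + I) ^ (2 * (j : ℤ) - 1)) / (2 : ℂ) ^ (2 * (j : ℤ) - 1))

end LambertZeta

end

namespace LambertZeta

open Complex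

/-! Put F(τ) = ζ(2r+1) + 2 ∑ n^(-2r-1) q^n/(1-q^n) with q = exp(2πiτ). Up to a constant factor this
is ∑ cot(πnτ)/n^(2r+1), and the partial fractions of the cotangent turn it into a double series.
Exchanging the two summation indices realises τ ↦ -1/τ, up to a finite geometric sum that factors
into products of even zeta values. This is Ramanujan's formula, `completedLambert_transform`.

For r = 2k the formula is applied at the points (i+n)/p, the Hecke translates of i, with p = 2 and p
= 3. Summing over the p-th roots of e^(-2π) (`oddLambert_add_neg`, `oddLambert_cube_roots`) leaves
only series at e^(-2π) and e^(-2pπ), while inversion sends the points to p·i and p(i±1)/2. So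
`relation_two` links ζ(4k+1) to the series at e^(-2π) and e^(-4π), and `relation_three` links it to
those at e^(-2π), e^(-6π) and -e^(-3π).

The unwanted series at e^(-2π) has coefficient 2·`aDen k` in the first relation and 2(3^(4k+1)+1) in
the second. Subtracting a_k/2^(4k) times the first from the second removes it and leaves ζ(4k+1)
with coefficient 2b_k. That b_k ≠ 0 rests on 64^k ≤ 81^k. -/

/-- The Lambert series at the negative odd integer `-(2 r + 1)`, with natural powers. -/
noncomputable def oddLambert (r : ℕ) (q : ℂ) : ℂ :=
  ∑' n : ℕ, q ^ (n + 1) / (((n : ℂ) + 1) ^ (2 * r + 1) * (1 - q ^ (n + 1)))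

/-! ### Convergence of the Lambert series and passage to natural exponents -/

lemma norm_oddLambert_term_le {q : ℂ} (hq : ‖q‖ < 1) (r n : ℕ) :
    ‖q ^ (n + 1) / (((n : ℂ) + 1) ^ (2 * r + 1) * (1 - q ^ (n + 1)))‖
      ≤ ‖q‖ ^ (n + 1) / (1 - ‖q‖) := by
  have h1 : (1 : ℝ) ≤ ‖((n : ℂ) + 1) ^ (2 * r + 1)‖ := by
    rw [norm_pow]
    apply one_le_pow₀
    rw [show (n : ℂ) + 1 = ((n + 1 : ℕ) : ℂ) by push_cast; rfl, norm_natCast]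
    push_cast
    linarith [(n.cast_nonneg : (0 : ℝ) ≤ n)]
  have h2 : 1 - ‖q‖ ≤ ‖1 - q ^ (n + 1)‖ := by
    have h3 : ‖q ^ (n + 1)‖ ≤ ‖q‖ := by
      rw [norm_pow]
      exact pow_le_of_le_one (norm_nonneg _) hq.le (by simp)
    have h4 := norm_sub_norm_le (1 : ℂ) (q ^ (n + 1))
    rw [norm_one] at h4
    linarith
  have h0 : 0 < 1 - ‖q‖ := by linarith
  rw [norm_div, norm_mul, norm_pow q]
  apply div_le_div_of_nonneg_left (by positivity) h0
  calc 1 - ‖q‖ ≤ ‖1 - q ^ (n + 1)‖ := h2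
    _ ≤ _ := le_mul_of_one_le_left (norm_nonneg _) h1

lemma summable_oddLambert {q : ℂ} (hq : ‖q‖ < 1) (r : ℕ) :
    Summable fun n : ℕ => q ^ (n + 1) / (((n : ℂ) + 1) ^ (2 * r + 1) * (1 - q ^ (n + 1))) := by
  refine Summable.of_norm_bounded ?_ (norm_oddLambert_term_le hq r)
  exact ((summable_nat_add_iff 1).2 (summable_geometric_of_lt_one (norm_nonneg q) hq)).div_const _

lemma lambertTerm_succ (k n : ℕ) (q : ℂ) :
    lambertTerm q (-4 * (k : ℂ) - 1) (n + 1)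
      = q ^ (n + 1) / (((n : ℂ) + 1) ^ (2 * (2 * k) + 1) * (1 - q ^ (n + 1))) := by
  have h : (-4 * (k : ℂ) - 1) = -((2 * (2 * k) + 1 : ℕ) : ℂ) := by push_cast; ring
  rw [lambertTerm, h, cpow_neg, cpow_natCast, div_mul_eq_div_div]
  push_cast
  ring

lemma summable_lambertTerm {q : ℂ} (hq : ‖q‖ < 1) (k : ℕ) :
    Summable fun n : ℕ => lambertTerm q (-4 * (k : ℂ) - 1) (n + 1) := by
  simp_rw [lambertTerm_succ]
  exact summable_oddLambert hq _

lemma lambertL_eq_oddLambert (k : ℕ) (q : ℂ) :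
    lambertL q (-4 * (k : ℂ) - 1) = oddLambert (2 * k) q := by
  simp_rw [lambertL, lambertTerm_succ, oddLambert]

lemma hasSum_zeta_succ {m : ℕ} (hm : 1 < m) :
    HasSum (fun n : ℕ => 1 / ((n : ℂ) + 1) ^ m) (riemannZeta m) := by
  have hs : Summable fun n : ℕ => 1 / (n : ℂ) ^ m := by
    rw [← summable_norm_iff]
    simpa using Real.summable_one_div_nat_pow.2 hm
  have h := (hasSum_nat_add_iff' 1).2 hs.hasSum
  rw [← zeta_nat_eq_tsum_of_gt_one hm] at h
  simpa [show m ≠ 0 by omega] using h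

/-! ### The double series -/

lemma norm_mul_sub_lower {τ : ℂ} (hτ : 0 < τ.im) (x y : ℝ) :
    |x| * τ.im ≤ ‖x * τ - y‖ ∧ |y| * (τ.im / ‖τ‖) ≤ ‖x * τ - y‖ := by
  have h0 : τ ≠ 0 := fun h => by simp [h] at hτ
  have hn : 0 < ‖τ‖ := norm_pos_iff.2 h0
  constructor
  · have h := abs_im_le_norm (x * τ - y)
    simpa [abs_mul, abs_of_pos hτ] using h
  -- Multiplying by the conjugate of τ makes the x-term real, so the imaginary part isolates y.
  · have h := abs_im_le_norm ((x * τ - y) * (starRingEnd ℂ) τ)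
    have h2 : ((x * τ - y) * (starRingEnd ℂ) τ).im = y * τ.im := by
      simp; ring
    rw [h2, abs_mul, abs_of_pos hτ, norm_mul, norm_conj] at h
    rw [← mul_div_assoc, div_le_iff₀ hn]
    exact h

/-- A lower bound in either variable alone allows each double series below to be dominated by a
product of two convergent single series. -/
lemma norm_sq_sub_sq_lower {τ : ℂ} (hτ : 0 < τ.im) (x y : ℝ) :
    x ^ 2 * τ.im ^ 2 ≤ ‖(x : ℂ) ^ 2 * τ ^ 2 - (y : ℂ) ^ 2‖ ∧
      y ^ 2 * (τ.im / ‖τ‖) ^ 2 ≤ ‖(x : ℂ) ^ 2 * τ ^ 2 - (y : ℂ) ^ 2‖ := by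
  have e : (x : ℂ) ^ 2 * τ ^ 2 - (y : ℂ) ^ 2 = (x * τ - y) * (x * τ - ((-y : ℝ) : ℂ)) := by
    push_cast; ring
  obtain ⟨a1, a2⟩ := norm_mul_sub_lower hτ x y
  obtain ⟨b1, b2⟩ := norm_mul_sub_lower hτ x (-y)
  rw [abs_neg] at b2
  rw [e, norm_mul, ← sq_abs x, ← sq_abs y]
  constructor
  · calc _ = (|x| * τ.im) * (|x| * τ.im) := by ring
      _ ≤ _ := mul_le_mul a1 b1 (by positivity) (norm_nonneg _)
  · calc _ = (|y| * (τ.im / ‖τ‖)) * (|y| * (τ.im / ‖τ‖)) := by ring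
      _ ≤ _ := mul_le_mul a2 b2 (by positivity) (norm_nonneg _)

lemma sq_mul_sq_sub_sq_ne_zero {τ : ℂ} (hτ : 0 < τ.im) (n m : ℕ) :
    ((n : ℂ) + 1) ^ 2 * τ ^ 2 - ((m : ℂ) + 1) ^ 2 ≠ 0 := by
  have h := (norm_sq_sub_sq_lower hτ (n + 1) (m + 1)).1
  push_cast at h
  rw [← norm_pos_iff]
  exact lt_of_lt_of_le (by positivity) h

lemma summable_inv_succ_pow {m : ℕ} (hm : 1 < m) :
    Summable fun n : ℕ => 1 / ((n : ℝ) + 1) ^ m := by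
  have := (summable_nat_add_iff 1).2 (Real.summable_one_div_nat_pow.2 hm)
  simpa using this

lemma norm_natCast_add_one (n : ℕ) : ‖(n : ℂ) + 1‖ = (n : ℝ) + 1 := by
  rw [show (n : ℂ) + 1 = ((n + 1 : ℕ) : ℂ) by push_cast; rfl, norm_natCast]
  push_cast; rfl

lemma summable_double_left {τ : ℂ} (hτ : 0 < τ.im) {r : ℕ} (hr : 1 ≤ r) :
    Summable fun p : ℕ × ℕ =>
      1 / (((p.1 : ℂ) + 1) ^ (2 * r) * (((p.1 : ℂ) + 1) ^ 2 * τ ^ 2 - ((p.2 : ℂ) + 1) ^ 2)) := by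
  have h0 : τ ≠ 0 := fun h => by simp [h] at hτ
  have hn : 0 < ‖τ‖ := norm_pos_iff.2 h0
  have hs := ((summable_inv_succ_pow (show 1 < 2 * r by omega)).mul_of_nonneg
    (summable_inv_succ_pow one_lt_two) (fun _ => by positivity) (fun _ => by positivity)).mul_left
      (1 / (τ.im / ‖τ‖) ^ 2)
  refine Summable.of_norm_bounded hs fun p => ?_
  have h := (norm_sq_sub_sq_lower hτ (p.1 + 1) (p.2 + 1)).2
  push_cast at h
  rw [norm_div, norm_one, norm_mul, norm_pow, norm_natCast_add_one, one_div_mul_one_div,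
    one_div_mul_one_div]
  apply one_div_le_one_div_of_le (by positivity)
  calc _ = ((p.1 : ℝ) + 1) ^ (2 * r) * (((p.2 : ℝ) + 1) ^ 2 * (τ.im / ‖τ‖) ^ 2) := by ring
    _ ≤ _ := by gcongr

lemma summable_double_right {τ : ℂ} (hτ : 0 < τ.im) {r : ℕ} (hr : 1 ≤ r) :
    Summable fun p : ℕ × ℕ =>
      1 / (((p.2 : ℂ) + 1) ^ (2 * r) * (((p.1 : ℂ) + 1) ^ 2 * τ ^ 2 - ((p.2 : ℂ) + 1) ^ 2)) := by
  have hs := ((summable_inv_succ_pow one_lt_two).mul_of_nonneg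
    (summable_inv_succ_pow (show 1 < 2 * r by omega)) (fun _ => by positivity)
      (fun _ => by positivity)).mul_left (1 / τ.im ^ 2)
  refine Summable.of_norm_bounded hs fun p => ?_
  have h := (norm_sq_sub_sq_lower hτ (p.1 + 1) (p.2 + 1)).1
  push_cast at h
  rw [norm_div, norm_one, norm_mul, norm_pow, norm_natCast_add_one, one_div_mul_one_div,
    one_div_mul_one_div]
  apply one_div_le_one_div_of_le (by positivity)
  calc _ = ((p.2 : ℝ) + 1) ^ (2 * r) * (((p.1 : ℝ) + 1) ^ 2 * τ.im ^ 2) := by ring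
    _ ≤ _ := by gcongr

/-! ### The cotangent expansion -/

lemma succ_mul_mem_integerComplement {τ : ℂ} (hτ : 0 < τ.im) (n : ℕ) :
    ((n : ℂ) + 1) * τ ∈ Complex.integerComplement := by
  rintro ⟨m, hm⟩
  have h := congrArg Complex.im hm
  simp at h
  rcases h with h | h
  · exact absurd h (by positivity)
  · exact hτ.ne' h

lemma pi_mul_cot_succ_mul {τ : ℂ} (hτ : 0 < τ.im) (n : ℕ) :
    (Real.pi : ℂ) * cot (Real.pi * (((n : ℂ) + 1) * τ)) = 1 / (((n : ℂ) + 1) * τ)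
      + ∑' m : ℕ, 2 * (((n : ℂ) + 1) * τ) /
        (((n : ℂ) + 1) ^ 2 * τ ^ 2 - ((m : ℂ) + 1) ^ 2) := by
  have h := cot_series_rep' (succ_mul_mem_integerComplement hτ n)
  rw [sub_eq_iff_eq_add'] at h
  rw [h]
  congr 1
  apply tsum_congr
  intro m
  have h1 := sq_mul_sq_sub_sq_ne_zero hτ n m
  have e : ((n : ℂ) + 1) ^ 2 * τ ^ 2 - ((m : ℂ) + 1) ^ 2
      = (((n : ℂ) + 1) * τ - (m + 1)) * (((n : ℂ) + 1) * τ + (m + 1)) := by ring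
  rw [e] at h1 ⊢
  rw [div_add_div _ _ (left_ne_zero_of_mul h1) (right_ne_zero_of_mul h1)]
  ring

/-- In the partial fraction expansion of each cotangent the polar term 1/(nτ) contributes to
ζ(2r+2)/τ; the other terms form the double series. -/
lemma hasSum_cot {τ : ℂ} (hτ : 0 < τ.im) {r : ℕ} (hr : 1 ≤ r) :
    HasSum (fun n : ℕ => (Real.pi : ℂ) * cot (Real.pi * (((n : ℂ) + 1) * τ))
        / ((n : ℂ) + 1) ^ (2 * r + 1))
      (riemannZeta (2 * (r + 1) : ℕ) / τ + 2 * τ * ∑' p : ℕ × ℕ,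
        1 / (((p.1 : ℂ) + 1) ^ (2 * r)
          * (((p.1 : ℂ) + 1) ^ 2 * τ ^ 2 - ((p.2 : ℂ) + 1) ^ 2))) := by
  have h0 : τ ≠ 0 := fun h => by simp [h] at hτ
  have hd := summable_double_left hτ hr
  have h1 := (hasSum_zeta_succ (show 1 < 2 * (r + 1) by omega)).div_const τ
  have h2 := (hd.hasSum.prod_fiberwise fun n => (hd.prod_factor n).hasSum).mul_left (2 * τ)
  refine (h1.add h2).congr_fun ?_
  intro n
  have hn : (n : ℂ) + 1 ≠ 0 := Nat.cast_add_one_ne_zero n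
  rw [pi_mul_cot_succ_mul hτ, add_div, ← tsum_div_const, ← tsum_mul_left]
  congr 1
  · field_simp
    ring
  · apply tsum_congr
    intro m
    have h1 := sq_mul_sq_sub_sq_ne_zero hτ n m
    field_simp
    ring

lemma norm_exp_two_pi_I_lt_one {τ : ℂ} (hτ : 0 < τ.im) :
    ‖exp (2 * Real.pi * I * τ)‖ < 1 := by
  rw [norm_exp, Real.exp_lt_one_iff]
  simp
  positivity

/-- `ζ(2 r + 1) + 2 ∑ n ^ (-2 r - 1) q ^ n / (1 - q ^ n)` at `q = exp (2 π i τ)`. -/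
noncomputable def completedLambert (r : ℕ) (τ : ℂ) : ℂ :=
  riemannZeta (2 * r + 1 : ℕ) + 2 * oddLambert r (exp (2 * Real.pi * I * τ))

/-- Termwise this is i·cot(πz) = 1 + 2q/(1-q) at z = nτ. -/
lemma pi_mul_completedLambert {τ : ℂ} (hτ : 0 < τ.im) {r : ℕ} (hr : 1 ≤ r) :
    Real.pi * completedLambert r τ
      = I * (riemannZeta (2 * (r + 1) : ℕ) / τ + 2 * τ * ∑' p : ℕ × ℕ,
        1 / (((p.1 : ℂ) + 1) ^ (2 * r)
          * (((p.1 : ℂ) + 1) ^ 2 * τ ^ 2 - ((p.2 : ℂ) + 1) ^ 2))) := by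
  have h1 := ((hasSum_zeta_succ (show 1 < 2 * r + 1 by omega)).add
    ((summable_oddLambert (norm_exp_two_pi_I_lt_one hτ) r).hasSum.mul_left 2)).mul_left
      (Real.pi : ℂ)
  refine h1.unique (((hasSum_cot hτ hr).mul_left I).congr_fun ?_)
  intro n
  have hn : (n : ℂ) + 1 ≠ 0 := Nat.cast_add_one_ne_zero n
  have hq : exp (2 * Real.pi * I * (((n : ℂ) + 1) * τ))
      = exp (2 * Real.pi * I * τ) ^ (n + 1) := by
    rw [← exp_nat_mul]; congr 1; push_cast; ring
  have hq1 : 1 - exp (2 * Real.pi * I * τ) ^ (n + 1) ≠ 0 := by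
    intro h
    have h3 : ‖exp (2 * Real.pi * I * τ) ^ (n + 1)‖ < 1 := by
      rw [norm_pow]
      exact pow_lt_one₀ (norm_nonneg _) (norm_exp_two_pi_I_lt_one hτ) (by simp)
    rw [← sub_eq_zero.1 h, norm_one] at h3
    exact lt_irrefl _ h3
  rw [cot_pi_eq_exp_ratio, hq]
  generalize exp (2 * Real.pi * I * τ) ^ (n + 1) = x at hq1 ⊢
  field_simp
  ring

/-! ### Reciprocity under τ ↦ -1/τ -/

/-- The common denominator n²τ² - m² divides (n²τ²)^r - (m²)^r. The quotient is a finite geometric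
sum of monomials, each of which separates into a product of two zeta series. -/
lemma double_sum_diff {τ : ℂ} (hτ : 0 < τ.im) {r : ℕ} (hr : 1 ≤ r) :
    (∑' p : ℕ × ℕ, 1 / (((p.1 : ℂ) + 1) ^ (2 * r)
          * (((p.1 : ℂ) + 1) ^ 2 * τ ^ 2 - ((p.2 : ℂ) + 1) ^ 2)))
      - τ ^ (2 * r) * ∑' p : ℕ × ℕ, 1 / (((p.2 : ℂ) + 1) ^ (2 * r)
          * (((p.1 : ℂ) + 1) ^ 2 * τ ^ 2 - ((p.2 : ℂ) + 1) ^ 2))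
      = -∑ i ∈ Finset.range r, τ ^ (2 * i)
          * (riemannZeta (2 * (r - i) : ℕ) * riemannZeta (2 * (i + 1) : ℕ)) := by
  have h1 := (summable_double_left hτ hr).hasSum.sub
    ((summable_double_right hτ hr).hasSum.mul_left (τ ^ (2 * r)))
  have key : ∀ m : ℕ, 1 < m → Summable fun n : ℕ => ‖1 / ((n : ℂ) + 1) ^ m‖ := fun m hm =>
    summable_norm_iff.2 (hasSum_zeta_succ hm).summable
  have h2 : HasSum (fun p : ℕ × ℕ => -∑ i ∈ Finset.range r, τ ^ (2 * i)
      * (1 / ((p.1 : ℂ) + 1) ^ (2 * (r - i)) * (1 / ((p.2 : ℂ) + 1) ^ (2 * (i + 1)))))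
      (-∑ i ∈ Finset.range r, τ ^ (2 * i)
          * (riemannZeta (2 * (r - i) : ℕ) * riemannZeta (2 * (i + 1) : ℕ))) := by
    refine (hasSum_sum fun i hi => ?_).neg
    have hi' := Finset.mem_range.1 hi
    have hu : 1 < 2 * (r - i) := by omega
    have hv : 1 < 2 * (i + 1) := by omega
    have hs := summable_mul_of_summable_norm (key _ hu) (key _ hv)
    have hp := (hasSum_zeta_succ hu).mul (hasSum_zeta_succ hv) hs
    exact hp.mul_left (τ ^ (2 * i))
  refine h1.unique (h2.congr_fun ?_)
  rintro ⟨n, m⟩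
  have hD := sq_mul_sq_sub_sq_ne_zero hτ n m
  have hn : (n : ℂ) + 1 ≠ 0 := Nat.cast_add_one_ne_zero n
  have hm : (m : ℂ) + 1 ≠ 0 := Nat.cast_add_one_ne_zero m
  dsimp only
  generalize (n : ℂ) + 1 = u at *
  generalize (m : ℂ) + 1 = v at *
  have hg := geom_sum₂_mul (u ^ 2 * τ ^ 2) (v ^ 2) r
  have e : ∀ i ∈ Finset.range r, τ ^ (2 * i) * (1 / u ^ (2 * (r - i)) * (1 / v ^ (2 * (i + 1))))
      = ((u ^ 2 * τ ^ 2) ^ i * (v ^ 2) ^ (r - 1 - i)) / (u ^ (2 * r) * v ^ (2 * r)) := by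
    intro i hi
    obtain ⟨d, rfl⟩ : ∃ d, r = i + 1 + d := ⟨r - (i + 1), by have := Finset.mem_range.1 hi; omega⟩
    rw [show i + 1 + d - i = d + 1 by omega, show i + 1 + d - 1 - i = d by omega]
    field_simp
    ring
  rw [Finset.sum_congr rfl e, ← Finset.sum_div, eq_div_of_mul_eq hD hg]
  field_simp
  ring

lemma neg_inv_im_pos {τ : ℂ} (hτ : 0 < τ.im) : 0 < (-1 / τ).im := by
  have h0 : τ ≠ 0 := fun h => by simp [h] at hτ
  have : 0 < normSq τ := normSq_pos.2 h0
  rw [neg_div, one_div, neg_im, inv_im]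
  rw [neg_div, neg_neg]
  positivity

/-- After n and m are exchanged, m²/τ² - n² = -(n²τ² - m²)/τ². -/
lemma double_sum_neg_inv {τ : ℂ} (hτ : 0 < τ.im) (r : ℕ) :
    (∑' p : ℕ × ℕ, 1 / (((p.1 : ℂ) + 1) ^ (2 * r)
          * (((p.1 : ℂ) + 1) ^ 2 * (-1 / τ) ^ 2 - ((p.2 : ℂ) + 1) ^ 2)))
      = -τ ^ 2 * ∑' p : ℕ × ℕ, 1 / (((p.2 : ℂ) + 1) ^ (2 * r)
          * (((p.1 : ℂ) + 1) ^ 2 * τ ^ 2 - ((p.2 : ℂ) + 1) ^ 2)) := by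
  have h0 : τ ≠ 0 := fun h => by simp [h] at hτ
  rw [← (Equiv.prodComm ℕ ℕ).tsum_eq (fun p : ℕ × ℕ => 1 / (((p.1 : ℂ) + 1) ^ (2 * r)
          * (((p.1 : ℂ) + 1) ^ 2 * (-1 / τ) ^ 2 - ((p.2 : ℂ) + 1) ^ 2))), ← tsum_mul_left]
  apply tsum_congr
  rintro ⟨n, m⟩
  have hD := sq_mul_sq_sub_sq_ne_zero hτ n m
  have hm : (m : ℂ) + 1 ≠ 0 := Nat.cast_add_one_ne_zero m
  simp only [Equiv.prodComm_apply, Prod.swap]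
  generalize (n : ℂ) + 1 = u at *
  generalize (m : ℂ) + 1 = v at *
  have e : v ^ 2 * (-1 / τ) ^ 2 - u ^ 2 = -(u ^ 2 * τ ^ 2 - v ^ 2) / τ ^ 2 := by
    field_simp
    ring
  rw [e]
  field_simp

/-- Ramanujan's formula, in terms of even zeta values. -/
lemma completedLambert_transform_zeta {τ : ℂ} (hτ : 0 < τ.im) {r : ℕ} (hr : 1 ≤ r) :
    Real.pi * τ * (completedLambert r τ - τ ^ (2 * r) * completedLambert r (-1 / τ))
      = -2 * I * ∑ j ∈ Finset.range (r + 2),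
          τ ^ (2 * j) * (riemannZeta (2 * (r + 1 - j) : ℕ) * riemannZeta (2 * j : ℕ)) := by
  have h0 : τ ≠ 0 := fun h => by simp [h] at hτ
  have h1 := pi_mul_completedLambert hτ hr
  have h2 := pi_mul_completedLambert (neg_inv_im_pos hτ) hr
  rw [double_sum_neg_inv hτ] at h2
  have h3 := double_sum_diff hτ hr
  rw [Finset.sum_range_succ, Finset.sum_range_succ']
  have e : ∀ i ∈ Finset.range r, τ ^ (2 * (i + 1))
        * (riemannZeta (2 * (r + 1 - (i + 1)) : ℕ) * riemannZeta (2 * (i + 1) : ℕ))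
      = τ ^ 2 * (τ ^ (2 * i) * (riemannZeta (2 * (r - i) : ℕ)
          * riemannZeta (2 * (i + 1) : ℕ))) := by
    intro i _
    rw [Nat.add_sub_add_right]
    ring
  rw [Finset.sum_congr rfl e, ← Finset.mul_sum]
  -- Since ζ(0) = -1/2, the end terms j = 0 and j = r+1 are exactly the contributions of the polar
  -- terms of the cotangents.
  simp only [Nat.sub_self, mul_zero, Nat.cast_zero, riemannZeta_zero, pow_zero, Nat.sub_zero]
  generalize (∑ i ∈ Finset.range r, τ ^ (2 * i)
    * (riemannZeta (2 * (r - i) : ℕ) * riemannZeta (2 * (i + 1) : ℕ))) = Z at *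
  generalize (∑' p : ℕ × ℕ, 1 / (((p.1 : ℂ) + 1) ^ (2 * r)
          * (((p.1 : ℂ) + 1) ^ 2 * τ ^ 2 - ((p.2 : ℂ) + 1) ^ 2))) = S at *
  generalize (∑' p : ℕ × ℕ, 1 / (((p.2 : ℂ) + 1) ^ (2 * r)
          * (((p.1 : ℂ) + 1) ^ 2 * τ ^ 2 - ((p.2 : ℂ) + 1) ^ 2))) = R at *
  generalize riemannZeta (2 * (r + 1) : ℕ) = z at *
  rw [show z / (-1 / τ) + 2 * (-1 / τ) * (-τ ^ 2 * R) = -τ * z + 2 * τ * R by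
    field_simp] at h2
  have h4 : τ * (z / τ) = z := by field_simp
  rw [mul_add] at h1
  linear_combination τ * h1 - τ ^ (2 * r + 1) * h2 + 2 * I * τ ^ 2 * h3 + I * h4

/-! ### Bernoulli numbers and the folded form of Ramanujan's formula -/

/-- The coefficient `B_{2j} B_{2m-2j} / ((2j)! (2m-2j)!)`. -/
noncomputable def bernoulliPair (m j : ℕ) : ℂ :=
  ((bernoulli (2 * j) : ℚ) : ℂ) * ((bernoulli (2 * m - 2 * j) : ℚ) : ℂ)
    / ((Nat.factorial (2 * j) : ℂ) * (Nat.factorial (2 * m - 2 * j) : ℂ))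

lemma bernoulliPair_reflect {m j : ℕ} (hj : j ≤ m) :
    bernoulliPair m (m - j) = bernoulliPair m j := by
  rw [bernoulliPair, bernoulliPair, show 2 * (m - j) = 2 * m - 2 * j by omega,
    show 2 * m - (2 * m - 2 * j) = 2 * j by omega]
  ring

/-- Euler's formula in this form also covers j = 0, so the end terms need no separate treatment. -/
lemma riemannZeta_even (j : ℕ) : riemannZeta (2 * j : ℕ)
    = (-1) ^ (j + 1) * (2 * Real.pi : ℂ) ^ (2 * j) / 2 * ((bernoulli (2 * j) : ℚ) : ℂ)
      / (Nat.factorial (2 * j) : ℂ) := by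
  push_cast
  rw [riemannZeta_two_mul_nat', zpow_sub₀ two_ne_zero, mul_pow]
  norm_cast
  push_cast
  ring

lemma riemannZeta_even_mul {m j : ℕ} (hj : j ≤ m) :
    riemannZeta (2 * (m - j) : ℕ) * riemannZeta (2 * j : ℕ)
      = (-1) ^ m * (2 * Real.pi : ℂ) ^ (2 * m) / 4 * bernoulliPair m j := by
  obtain ⟨d, rfl⟩ := Nat.exists_eq_add_of_le hj
  rw [riemannZeta_even, riemannZeta_even, bernoulliPair, show j + d - j = d by omega,
    show 2 * (j + d) - 2 * j = 2 * d by omega]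
  ring

lemma completedLambert_transform {τ : ℂ} (hτ : 0 < τ.im) {r : ℕ} (hr : 1 ≤ r) :
    τ * (completedLambert r τ - τ ^ (2 * r) * completedLambert r (-1 / τ))
      = (-1) ^ r * I * (2 * Real.pi) ^ (2 * r + 1) * ∑ j ∈ Finset.range (r + 2),
          bernoulliPair (r + 1) j * τ ^ (2 * j) := by
  have hpi : (Real.pi : ℂ) ≠ 0 := ofReal_ne_zero.2 Real.pi_ne_zero
  have h := completedLambert_transform_zeta hτ hr
  have e : ∀ j ∈ Finset.range (r + 2),
      τ ^ (2 * j) * (riemannZeta (2 * (r + 1 - j) : ℕ) * riemannZeta (2 * j : ℕ))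
        = (-1) ^ (r + 1) * (2 * Real.pi : ℂ) ^ (2 * (r + 1)) / 4
          * (bernoulliPair (r + 1) j * τ ^ (2 * j)) := by
    intro j hj
    rw [riemannZeta_even_mul (by have := Finset.mem_range.1 hj; omega)]
    ring
  rw [Finset.sum_congr rfl e, ← Finset.mul_sum] at h
  apply mul_left_cancel₀ hpi
  linear_combination h

/-- Ramanujan's formula for `ζ(4 k + 1)`, with the Bernoulli sum folded by symmetry. -/
lemma completedLambert_transform_folded {τ : ℂ} (hτ : 0 < τ.im) {k : ℕ} (hk : 1 ≤ k) :
    completedLambert (2 * k) τ - τ ^ (4 * k) * completedLambert (2 * k) (-1 / τ)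
      = I * (2 * Real.pi) ^ (4 * k + 1) * ∑ j ∈ Finset.range (k + 1),
          bernoulliPair (2 * k + 1) j
            * (τ ^ (2 * (j : ℤ) - 1) + τ ^ (4 * (k : ℤ) + 1 - 2 * (j : ℤ))) := by
  have h0 : τ ≠ 0 := fun h => by simp [h] at hτ
  have h := completedLambert_transform hτ (show 1 ≤ 2 * k by omega)
  rw [show 2 * (2 * k) = 4 * k by ring, pow_mul (-1 : ℂ), neg_one_sq, one_pow, one_mul] at h
  have e : ∑ j ∈ Finset.range (2 * k + 2), bernoulliPair (2 * k + 1) j * τ ^ (2 * j)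
      = τ * ∑ j ∈ Finset.range (k + 1), bernoulliPair (2 * k + 1) j
            * (τ ^ (2 * (j : ℤ) - 1) + τ ^ (4 * (k : ℤ) + 1 - 2 * (j : ℤ))) := by
    rw [show 2 * k + 2 = (k + 1) + (k + 1) by ring, Finset.sum_range_add,
      ← Finset.sum_range_reflect (fun x => bernoulliPair (2 * k + 1) (k + 1 + x)
        * τ ^ (2 * (k + 1 + x))), ← Finset.sum_add_distrib, Finset.mul_sum]
    apply Finset.sum_congr rfl
    intro j hj
    have hj' := Finset.mem_range.1 hj
    obtain ⟨d, rfl⟩ : ∃ d, k = j + d := ⟨k - j, by omega⟩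
    -- Reversing the upper half pairs j with 2k+1-j, where the Bernoulli coefficient is the same.
    rw [show j + d + 1 + (j + d + 1 - 1 - j) = 2 * (j + d) + 1 - j by omega,
      bernoulliPair_reflect (by omega), show 2 * (j + d) + 1 - j = j + 2 * d + 1 by omega,
      show (4 * ((j + d : ℕ) : ℤ) + 1 - 2 * (j : ℤ)) = ((2 * j + 4 * d + 1 : ℕ) : ℤ) by
        push_cast; ring, zpow_natCast, zpow_sub₀ h0, zpow_one,
      show (2 * (j : ℤ)) = ((2 * j : ℕ) : ℤ) by push_cast; ring, zpow_natCast]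
    field_simp
    ring
  rw [e] at h
  apply mul_left_cancel₀ h0
  linear_combination h

/-! ### Summation over square and cube roots of the nome -/

/-- Indexing from 0 is harmless because the term at 0 is a division by zero, hence 0. The multiples
of a prime are then a plain range of indices. -/
lemma hasSum_oddLambert {q : ℂ} (hq : ‖q‖ < 1) (r : ℕ) :
    HasSum (fun n : ℕ => q ^ n / ((n : ℂ) ^ (2 * r + 1) * (1 - q ^ n))) (oddLambert r q) := by
  have h : HasSum (fun n : ℕ => q ^ (n + 1) / (((n + 1 : ℕ) : ℂ) ^ (2 * r + 1)
      * (1 - q ^ (n + 1)))) (oddLambert r q) := by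
    push_cast
    exact (summable_oddLambert hq r).hasSum
  have h2 := (hasSum_nat_add_iff
    (f := fun n : ℕ => q ^ n / ((n : ℂ) ^ (2 * r + 1) * (1 - q ^ n))) 1).1 h
  rwa [Finset.sum_range_one, pow_zero, sub_self, mul_zero, div_zero, add_zero] at h2

lemma one_sub_pow_ne_zero {q : ℂ} (hq : ‖q‖ < 1) {n : ℕ} (hn : n ≠ 0) : 1 - q ^ n ≠ 0 := by
  intro h
  have h3 : ‖q ^ n‖ < 1 := by
    rw [norm_pow]
    exact pow_lt_one₀ (norm_nonneg _) hq hn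
  rw [← sub_eq_zero.1 h, norm_one] at h3
  exact lt_irrefl _ h3

lemma norm_pow_lt_one {q : ℂ} (hq : ‖q‖ < 1) {n : ℕ} (hn : n ≠ 0) : ‖q ^ n‖ < 1 := by
  rw [norm_pow]
  exact pow_lt_one₀ (norm_nonneg _) hq hn

/-- For odd n the terms cancel by x/(1-x) - x/(1+x) = 2x²/(1-x²); the even n = 2m give the
right-hand side. -/
lemma oddLambert_add_neg {w : ℂ} (hw : ‖w‖ < 1) (r : ℕ) :
    oddLambert r w + oddLambert r (-w) - 2 * oddLambert r (w ^ 2)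
      = 2 / 2 ^ (2 * r + 1) * (oddLambert r (w ^ 2) - oddLambert r (w ^ 4)) := by
  have hw' : ‖-w‖ < 1 := by rwa [norm_neg]
  have hA := (((hasSum_oddLambert hw r).add (hasSum_oddLambert hw' r)).sub
    ((hasSum_oddLambert (norm_pow_lt_one hw two_ne_zero) r).mul_left 2))
  have hB := ((hasSum_oddLambert (norm_pow_lt_one hw two_ne_zero) r).sub
    (hasSum_oddLambert (norm_pow_lt_one hw four_ne_zero) r)).mul_left (2 / 2 ^ (2 * r + 1))
  have hinj : Function.Injective fun m : ℕ => 2 * m := fun x y h => by simpa using h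
  -- Once the odd terms are known to vanish, the sum may be restricted to n = 2m.
  refine ((hinj.hasSum_iff ?_).2 hA).unique (hB.congr_fun ?_)
  · intro n hn
    have hodd : Odd n := by
      rw [← Nat.not_even_iff_odd]
      rintro ⟨m, rfl⟩
      exact hn ⟨m, by dsimp only; ring⟩
    have hn0 : n ≠ 0 := fun h => by simp [h] at hodd
    have h1 := one_sub_pow_ne_zero hw hn0
    have h2 := one_sub_pow_ne_zero hw' hn0
    have h3 := one_sub_pow_ne_zero (norm_pow_lt_one hw two_ne_zero) hn0
    have hc : (n : ℂ) ≠ 0 := Nat.cast_ne_zero.2 hn0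
    rw [pow_right_comm] at h3 ⊢
    rw [hodd.neg_pow] at h2 ⊢
    generalize w ^ n = x at *
    field_simp
    ring
  · intro m
    simp only [Function.comp_apply]
    rcases eq_or_ne m 0 with rfl | hm
    · simp
    have h1 := one_sub_pow_ne_zero (norm_pow_lt_one hw two_ne_zero) hm
    have h2 := one_sub_pow_ne_zero (norm_pow_lt_one hw four_ne_zero) hm
    have hc : (m : ℂ) ≠ 0 := Nat.cast_ne_zero.2 hm
    have e1 : w ^ (2 * m) = (w ^ 2) ^ m := pow_mul _ _ _
    have e2 : (-w) ^ (2 * m) = (w ^ 2) ^ m := by rw [pow_mul, neg_sq]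
    have e3 : (w ^ 2) ^ (2 * m) = (w ^ 4) ^ m := by ring
    rw [e1, e2, e3]
    push_cast
    rw [mul_pow]
    generalize (w ^ 2) ^ m = x at *
    generalize (w ^ 4) ^ m = y at *
    field_simp
    ring

/-- This is -x times the logarithmic derivative of (1-x)(1-ωx)(1-ω²x) = 1-x³. -/
lemma sum_cube_roots_div {x ω : ℂ} (hω : 1 + ω + ω ^ 2 = 0) (h0 : 1 - x ≠ 0)
    (h1 : 1 - ω * x ≠ 0) (h2 : 1 - ω ^ 2 * x ≠ 0) :
    x / (1 - x) + ω * x / (1 - ω * x) + ω ^ 2 * x / (1 - ω ^ 2 * x)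
      = 3 * (x ^ 3 / (1 - x ^ 3)) := by
  have hω3 : ω ^ 3 = 1 := by linear_combination (ω - 1) * hω
  have e : 1 - x ^ 3 = (1 - x) * ((1 - ω * x) * (1 - ω ^ 2 * x)) := by
    linear_combination (x - x ^ 2) * hω - (x ^ 2 - x ^ 3) * hω3
  rw [div_add_div _ _ h0 h1, div_add_div _ _ (mul_ne_zero h0 h1) h2, ← mul_div_assoc, e]
  congr 1
  · linear_combination (x - 2 * x ^ 2) * hω + (3 * x ^ 3 - 2 * x ^ 2) * hω3
  · ring

lemma oddLambert_cube_roots {w ω : ℂ} (hw : ‖w‖ < 1) (hω : 1 + ω + ω ^ 2 = 0) (r : ℕ) :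
    oddLambert r w + oddLambert r (ω * w) + oddLambert r (ω ^ 2 * w)
        - 3 * oddLambert r (w ^ 3)
      = 3 / 3 ^ (2 * r + 1) * (oddLambert r (w ^ 3) - oddLambert r (w ^ 9)) := by
  have hω3 : ω ^ 3 = 1 := by linear_combination (ω - 1) * hω
  have hωn : ‖ω‖ = 1 := by
    have h := congrArg norm hω3
    rw [norm_pow, norm_one] at h
    exact (pow_eq_one_iff_of_nonneg (norm_nonneg _) (by norm_num)).1 h
  have hw1 : ‖ω * w‖ < 1 := by rwa [norm_mul, hωn, one_mul]
  have hw2 : ‖ω ^ 2 * w‖ < 1 := by rwa [norm_mul, norm_pow, hωn, one_pow, one_mul]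
  have hw3 : ‖w ^ 3‖ < 1 := norm_pow_lt_one hw (by norm_num)
  have hw9 : ‖w ^ 9‖ < 1 := norm_pow_lt_one hw (by norm_num)
  have hA := ((((hasSum_oddLambert hw r).add (hasSum_oddLambert hw1 r)).add
    (hasSum_oddLambert hw2 r)).sub ((hasSum_oddLambert hw3 r).mul_left 3))
  have hB := ((hasSum_oddLambert hw3 r).sub
    (hasSum_oddLambert hw9 r)).mul_left (3 / 3 ^ (2 * r + 1))
  have hinj : Function.Injective fun m : ℕ => 3 * m := fun x y h => by simpa using h
  refine ((hinj.hasSum_iff ?_).2 hA).unique (hB.congr_fun ?_)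
  · intro n hn
    have hn0 : n ≠ 0 := by
      rintro rfl
      exact hn ⟨0, rfl⟩
    have h0 := one_sub_pow_ne_zero hw hn0
    have h1 := one_sub_pow_ne_zero hw1 hn0
    have h2 := one_sub_pow_ne_zero hw2 hn0
    -- When 3 does not divide n, the power ω^n is again a primitive cube root of unity.
    have hη : 1 + ω ^ n + (ω ^ n) ^ 2 = 0 := by
      have hd := Nat.div_add_mod n 3
      have hlt := Nat.mod_lt n (show 3 > 0 by norm_num)
      have hne : n % 3 ≠ 0 := fun h => hn ⟨n / 3, by dsimp only; omega⟩
      have hp : ω ^ n = ω ^ (n % 3) := by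
        conv_lhs => rw [← hd, pow_add, pow_mul, hω3, one_pow, one_mul]
      rw [hp]
      obtain h | h : n % 3 = 1 ∨ n % 3 = 2 := by omega
      · rw [h, pow_one, hω]
      · rw [h]
        linear_combination hω + ω * hω3
    rw [pow_right_comm]
    rw [mul_pow] at h1 h2 ⊢
    rw [mul_pow, pow_right_comm ω 2 n]
    rw [pow_right_comm ω 2 n] at h2
    have h := sum_cube_roots_div hη h0 h1 h2
    generalize w ^ n = x at *
    simp only [mul_comm ((n : ℂ) ^ (2 * r + 1)), ← div_div, ← add_div, h]
    ring
  · intro m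
    simp only [Function.comp_apply]
    rcases eq_or_ne m 0 with rfl | hm
    · simp
    have h1 := one_sub_pow_ne_zero hw3 hm
    have h2 := one_sub_pow_ne_zero hw9 hm
    have hc : (m : ℂ) ≠ 0 := Nat.cast_ne_zero.2 hm
    have e1 : w ^ (3 * m) = (w ^ 3) ^ m := pow_mul _ _ _
    have e2 : (ω * w) ^ (3 * m) = (w ^ 3) ^ m := by rw [pow_mul, mul_pow, hω3, one_mul]
    have e3 : (ω ^ 2 * w) ^ (3 * m) = (w ^ 3) ^ m := by
      rw [pow_mul, mul_pow, pow_right_comm, hω3, one_pow, one_mul]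
    have e4 : (w ^ 3) ^ (3 * m) = (w ^ 9) ^ m := by ring
    rw [e1, e2, e3, e4]
    push_cast
    rw [mul_pow]
    generalize (w ^ 3) ^ m = x at *
    generalize (w ^ 9) ^ m = y at *
    field_simp
    ring

/-! ### Ramanujan's formula at the points iz/p -/

lemma I_pow_four_mul (k : ℕ) : I ^ (4 * k) = 1 := by
  rw [pow_mul, I_pow_four, one_pow]

lemma I_zpow_two_mul (j : ℕ) : I ^ (2 * (j : ℤ)) = (-1) ^ j := by
  rw [zpow_mul, zpow_natCast, zpow_ofNat, I_sq]

lemma I_mul_I_zpow_sub_one (j : ℕ) : I * I ^ (2 * (j : ℤ) - 1) = (-1) ^ j := by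
  rw [zpow_sub₀ I_ne_zero, I_zpow_two_mul, zpow_one]
  field_simp

lemma I_mul_I_zpow_sub (j k : ℕ) :
    I * I ^ (4 * (k : ℤ) + 1 - 2 * (j : ℤ)) = -(-1) ^ j := by
  rw [zpow_sub₀ I_ne_zero, I_zpow_two_mul, zpow_add₀ I_ne_zero, zpow_one,
    show (4 * (k : ℤ)) = ((4 * k : ℕ) : ℤ) by push_cast; ring, zpow_natCast, I_pow_four_mul]
  rcases neg_one_pow_eq_or ℂ j with h | h <;> rw [h]
  · linear_combination I_sq
  · linear_combination -I_sq

/-- The value at `I * z / p` of the `j`-th term of the folded Bernoulli sum. -/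
lemma pow_mul_I_mul_folded_term {z p : ℂ} (hp : p ≠ 0) (j k : ℕ) :
    p ^ (4 * k) * (I * ((I * z / p) ^ (2 * (j : ℤ) - 1)
        + (I * z / p) ^ (4 * (k : ℤ) + 1 - 2 * (j : ℤ))))
      = (-1) ^ (j + 1) * (p ^ (2 * (j : ℤ) - 1) * z ^ (4 * (k : ℤ) + 1 - 2 * (j : ℤ))
          - p ^ (4 * (k : ℤ) + 1 - 2 * (j : ℤ)) * z ^ (2 * (j : ℤ) - 1)) := by
  have h1 := I_mul_I_zpow_sub_one j
  have h2 := I_mul_I_zpow_sub j k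
  have h3 : p ^ (2 * (j : ℤ) - 1) * p ^ (4 * (k : ℤ) + 1 - 2 * (j : ℤ)) = p ^ (4 * k) := by
    rw [← zpow_add₀ hp, ← zpow_natCast p (4 * k)]
    congr 1
    push_cast
    ring
  have hf : p ^ (2 * (j : ℤ) - 1) ≠ 0 := zpow_ne_zero _ hp
  have he : p ^ (4 * (k : ℤ) + 1 - 2 * (j : ℤ)) ≠ 0 := zpow_ne_zero _ hp
  simp only [div_zpow, mul_zpow, ← h3]
  generalize p ^ (2 * (j : ℤ) - 1) = P at *
  generalize p ^ (4 * (k : ℤ) + 1 - 2 * (j : ℤ)) = R at *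
  field_simp
  linear_combination (z ^ (2 * (j : ℤ) - 1) * R) * h1
    + (P * z ^ (4 * (k : ℤ) + 1 - 2 * (j : ℤ))) * h2

/-- Here (1+i)^4 = -4, which is the source of (-1)^k 2^(2k) in a_k and b_k. -/
lemma I_add_one_pow (k : ℕ) : (1 + I) ^ (4 * k) = (-1) ^ k * 2 ^ (2 * k) := by
  rw [pow_mul, pow_mul, ← mul_pow]
  congr 1
  linear_combination (6 + 4 * I + I ^ 2 - 1) * I_sq

lemma I_sub_one_pow (k : ℕ) : (1 - I) ^ (4 * k) = (-1) ^ k * 2 ^ (2 * k) := by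
  rw [pow_mul, pow_mul, ← mul_pow]
  congr 1
  linear_combination (6 - 4 * I + I ^ 2 - 1) * I_sq

/-- The value at `I * z / p` of the folded transformation formula, cleared of denominators. -/
lemma completedLambert_transform_at {z p : ℂ} (hp : p ≠ 0) (h : 0 < (I * z / p).im)
    {k : ℕ} (hk : 1 ≤ k) :
    p ^ (4 * k) * completedLambert (2 * k) (I * z / p)
        - z ^ (4 * k) * completedLambert (2 * k) (-1 / (I * z / p))
      = (2 * Real.pi) ^ (4 * k + 1) * ∑ j ∈ Finset.range (k + 1),
          bernoulliPair (2 * k + 1) j * ((-1) ^ (j + 1)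
            * (p ^ (2 * (j : ℤ) - 1) * z ^ (4 * (k : ℤ) + 1 - 2 * (j : ℤ))
              - p ^ (4 * (k : ℤ) + 1 - 2 * (j : ℤ)) * z ^ (2 * (j : ℤ) - 1))) := by
  have h1 := completedLambert_transform_folded h hk
  have h2 : p ^ (4 * k) * (I * z / p) ^ (4 * k) = z ^ (4 * k) := by
    rw [div_pow, mul_pow, I_pow_four_mul]
    field_simp
  simp_rw [← pow_mul_I_mul_folded_term hp]
  have e : ∀ j : ℕ, bernoulliPair (2 * k + 1) j * (p ^ (4 * k) * (I
      * ((I * z / p) ^ (2 * (j : ℤ) - 1) + (I * z / p) ^ (4 * (k : ℤ) + 1 - 2 * (j : ℤ)))))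
      = (p ^ (4 * k) * I) * (bernoulliPair (2 * k + 1) j
      * ((I * z / p) ^ (2 * (j : ℤ) - 1) + (I * z / p) ^ (4 * (k : ℤ) + 1 - 2 * (j : ℤ)))) :=
    fun j => by ring
  simp_rw [e, ← Finset.mul_sum]
  linear_combination p ^ (4 * k) * h1 + completedLambert (2 * k) (-1 / (I * z / p)) * h2

lemma completedLambert_eq (r : ℕ) {τ q : ℂ} (h : exp (2 * Real.pi * I * τ) = q) :
    completedLambert r τ = riemannZeta (2 * r + 1 : ℕ) + 2 * oddLambert r q := by
  rw [completedLambert, h]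

/-- The norm 2 of 1+i leaves a denominator 2: for p = 2 the real part of the image is an integer,
for p = 3 a half-integer, whence the negative nome -e^(-3π). -/
lemma neg_one_div_one_add_I (p : ℂ) (hp : p ≠ 0) : -1 / (I * (1 + I) / p) = p * (1 + I) / 2 := by
  have h1 : (1 + I) ≠ 0 := fun h => by simpa using congrArg re h
  field_simp
  linear_combination (-2 - I) * I_sq

lemma neg_one_div_one_sub_I (p : ℂ) (hp : p ≠ 0) : -1 / (I * (1 - I) / p) = p * (I - 1) / 2 := by
  have h1 : (1 - I) ≠ 0 := fun h => by simpa using congrArg re h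
  field_simp
  linear_combination (-2 + I) * I_sq

lemma neg_one_div_I (p : ℂ) (hp : p ≠ 0) : -1 / (I * 1 / p) = p * I := by
  field_simp
  linear_combination -I_sq

lemma exp_quot_periodic {τ : ℂ} (x : ℝ) (n : ℤ) (h : τ = x * I + n) :
    exp (2 * Real.pi * I * τ) = (Real.exp (-2 * Real.pi * x) : ℝ) := by
  rw [ofReal_exp, exp_eq_exp_iff_exists_int]
  refine ⟨n, ?_⟩
  rw [h]
  push_cast
  linear_combination 2 * Real.pi * x * I_sq

lemma exp_quot_half {τ : ℂ} (x : ℝ) (n : ℤ) (h : τ = x * I + n + 1 / 2) :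
    exp (2 * Real.pi * I * τ) = ((-Real.exp (-2 * Real.pi * x) : ℝ) : ℂ) := by
  rw [h, mul_add, exp_add, exp_quot_periodic x n rfl,
    show 2 * Real.pi * I * (1 / 2) = Real.pi * I by ring, exp_pi_mul_I]
  push_cast
  ring

lemma ofReal_exp_pow {x y : ℝ} {n : ℕ} (h : n * x = y) :
    ((Real.exp x : ℝ) : ℂ) ^ n = (Real.exp y : ℝ) := by
  rw [← ofReal_pow, ← Real.exp_nat_mul, h]

/-! ### The Hecke relations at i for the primes 2 and 3 -/

/-- The relation obtained from the Hecke operator at `2`. -/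
lemma relation_two {k : ℕ} (hk : 1 ≤ k) :
    2 ^ (4 * k) * (2 * riemannZeta (4 * k + 1 : ℕ)
        + 4 * oddLambert (2 * k) (Real.exp (-2 * Real.pi) : ℝ))
      + 2 * (oddLambert (2 * k) (Real.exp (-2 * Real.pi) : ℝ)
        - oddLambert (2 * k) (Real.exp (-4 * Real.pi) : ℝ))
      - (riemannZeta (4 * k + 1 : ℕ) + 2 * oddLambert (2 * k) (Real.exp (-4 * Real.pi) : ℝ))
      - (-1) ^ k * 2 ^ (2 * k) * (riemannZeta (4 * k + 1 : ℕ)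
        + 2 * oddLambert (2 * k) (Real.exp (-2 * Real.pi) : ℝ))
      = (2 * Real.pi) ^ (4 * k + 1) * ∑ j ∈ Finset.range (k + 1),
          bernoulliPair (2 * k + 1) j * ((-1) ^ (j + 1)
            * (2 ^ (2 * (j : ℤ) - 1) * (1 + (1 + I) ^ (4 * (k : ℤ) + 1 - 2 * (j : ℤ)))
              - 2 ^ (4 * (k : ℤ) + 1 - 2 * (j : ℤ)) * (1 + (1 + I) ^ (2 * (j : ℤ) - 1)))) := by
  have hA := completedLambert_transform_at (z := 1) (p := 2) two_ne_zero (by simp) hk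
  have hB := completedLambert_transform_at (z := 1 + I) (p := 2) two_ne_zero (by simp) hk
  rw [neg_one_div_I 2 two_ne_zero] at hA
  rw [neg_one_div_one_add_I 2 two_ne_zero, I_add_one_pow] at hB
  set w : ℂ := ((Real.exp (-Real.pi) : ℝ) : ℂ) with hw
  have q1 : exp (2 * Real.pi * I * (I * 1 / 2)) = w := by
    rw [exp_quot_periodic (1 / 2) 0 (by push_cast; ring)]
    congr 2; ring
  have q2 : exp (2 * Real.pi * I * (I * (1 + I) / 2)) = -w := by
    -- The point is i/2 - 1/2, and its real part is written as -1 + 1/2.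
    rw [exp_quot_half (1 / 2) (-1) (by push_cast; linear_combination I_sq / 2), hw]
    push_cast
    congr 2; ring
  have q3 : exp (2 * Real.pi * I * (2 * I)) = (Real.exp (-4 * Real.pi) : ℝ) := by
    rw [exp_quot_periodic 2 0 (by push_cast; ring)]
    congr 2; ring
  have q4 : exp (2 * Real.pi * I * (2 * (1 + I) / 2)) = (Real.exp (-2 * Real.pi) : ℝ) := by
    rw [exp_quot_periodic 1 1 (by push_cast; ring)]
    congr 2; ring
  have hw1 : ‖w‖ < 1 := by
    rw [hw, norm_real, Real.norm_eq_abs, Real.abs_exp, Real.exp_lt_one_iff]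
    linarith [Real.pi_pos]
  have hH := oddLambert_add_neg hw1 (2 * k)
  rw [show w ^ 2 = (Real.exp (-2 * Real.pi) : ℝ) from ofReal_exp_pow (by push_cast; ring),
    show w ^ 4 = (Real.exp (-4 * Real.pi) : ℝ) from ofReal_exp_pow (by push_cast; ring),
    show 2 * (2 * k) + 1 = 4 * k + 1 by ring] at hH
  rw [completedLambert_eq _ q1, completedLambert_eq _ q3, one_pow,
    show 2 * (2 * k) + 1 = 4 * k + 1 by ring] at hA
  rw [completedLambert_eq _ q2, completedLambert_eq _ q4,
    show 2 * (2 * k) + 1 = 4 * k + 1 by ring] at hB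
  have h2 : (2 : ℂ) ^ (4 * k) * (2 / 2 ^ (4 * k + 1)) = 1 := by
    rw [pow_succ]; field_simp
  have hS : ∀ j : ℕ, bernoulliPair (2 * k + 1) j * ((-1) ^ (j + 1)
            * (2 ^ (2 * (j : ℤ) - 1) * (1 + (1 + I) ^ (4 * (k : ℤ) + 1 - 2 * (j : ℤ)))
              - 2 ^ (4 * (k : ℤ) + 1 - 2 * (j : ℤ)) * (1 + (1 + I) ^ (2 * (j : ℤ) - 1))))
      = bernoulliPair (2 * k + 1) j * ((-1) ^ (j + 1)
            * (2 ^ (2 * (j : ℤ) - 1) * 1 ^ (4 * (k : ℤ) + 1 - 2 * (j : ℤ))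
              - 2 ^ (4 * (k : ℤ) + 1 - 2 * (j : ℤ)) * 1 ^ (2 * (j : ℤ) - 1)))
        + bernoulliPair (2 * k + 1) j * ((-1) ^ (j + 1)
            * (2 ^ (2 * (j : ℤ) - 1) * (1 + I) ^ (4 * (k : ℤ) + 1 - 2 * (j : ℤ))
              - 2 ^ (4 * (k : ℤ) + 1 - 2 * (j : ℤ)) * (1 + I) ^ (2 * (j : ℤ) - 1))) := by
    intro j
    rw [one_zpow, one_zpow]
    ring
  simp_rw [hS]
  rw [Finset.sum_add_distrib]
  -- The series at ±e^(-π) enter with weight 2·2^(4k), and `hH` trades them for those at e^(-2π) and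
  -- e^(-4π).
  linear_combination hA + hB + (-2 * 2 ^ (4 * k)) * hH
    - 2 * (oddLambert (2 * k) (Real.exp (-2 * Real.pi) : ℝ)
        - oddLambert (2 * k) (Real.exp (-4 * Real.pi) : ℝ)) * h2

/-- The relation obtained from the Hecke operator at `3`. -/
lemma relation_three {k : ℕ} (hk : 1 ≤ k) :
    3 ^ (4 * k) * (3 * riemannZeta (4 * k + 1 : ℕ)
        + 6 * oddLambert (2 * k) (Real.exp (-2 * Real.pi) : ℝ))
      + 2 * (oddLambert (2 * k) (Real.exp (-2 * Real.pi) : ℝ)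
        - oddLambert (2 * k) (Real.exp (-6 * Real.pi) : ℝ))
      - (riemannZeta (4 * k + 1 : ℕ) + 2 * oddLambert (2 * k) (Real.exp (-6 * Real.pi) : ℝ))
      - 2 * (-1) ^ k * 2 ^ (2 * k) * (riemannZeta (4 * k + 1 : ℕ)
        + 2 * oddLambert (2 * k) ((-Real.exp (-3 * Real.pi) : ℝ) : ℂ))
      = (2 * Real.pi) ^ (4 * k + 1) * ∑ j ∈ Finset.range (k + 1),
          bernoulliPair (2 * k + 1) j * ((-1) ^ (j + 1)
            * ((3 : ℂ) ^ (2 * (j : ℤ) - 1)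
      * ∑ n ∈ Finset.Icc (-1 : ℤ) 1, (1 + I * (n : ℂ)) ^ (4 * (k : ℤ) + 1 - 2 * (j : ℤ))
    - (3 : ℂ) ^ (4 * (k : ℤ) + 1 - 2 * (j : ℤ))
      * ∑ n ∈ Finset.Icc (-1 : ℤ) 1, (1 + I * (n : ℂ)) ^ (2 * (j : ℤ) - 1))) := by
  have h30 : (3 : ℂ) ≠ 0 := by norm_num
  have him : ∀ z : ℂ, (I * z / 3).im = z.re / 3 := fun z => by
    rw [show (3 : ℂ) = ((3 : ℝ) : ℂ) by norm_num, div_ofReal_im]; simp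
  have hA := completedLambert_transform_at (z := 1) (p := 3) h30 (by rw [him]; simp) hk
  have hB := completedLambert_transform_at (z := 1 + I) (p := 3) h30 (by rw [him]; simp) hk
  have hC := completedLambert_transform_at (z := 1 - I) (p := 3) h30 (by rw [him]; simp) hk
  rw [neg_one_div_I 3 h30] at hA
  rw [neg_one_div_one_add_I 3 h30, I_add_one_pow] at hB
  rw [neg_one_div_one_sub_I 3 h30, I_sub_one_pow] at hC
  set w : ℂ := exp (2 * Real.pi * I * (I * 1 / 3)) with hw
  have hw' : w = (Real.exp (-2 * Real.pi / 3) : ℝ) := by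
    rw [hw, exp_quot_periodic (1 / 3) 0 (by push_cast; ring)]
    congr 2; ring
  set ω : ℂ := exp (2 * Real.pi * I / 3) with hωdef
  have hω : 1 + ω + ω ^ 2 = 0 := by
    have h := (isPrimitiveRoot_exp 3 (by norm_num)).geom_sum_eq_zero (by norm_num)
    simpa [Finset.sum_range_succ, hωdef] using h
  have q2 : exp (2 * Real.pi * I * (I * (1 + I) / 3)) = ω ^ 2 * w := by
    rw [hωdef, hw, ← exp_nat_mul, ← exp_add, exp_eq_exp_iff_exists_int]
    -- The point is (i-1)/3, so the factor is ω⁻¹ = ω²; the shift by -1 accounts for this rewriting.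
    refine ⟨-1, ?_⟩
    push_cast
    linear_combination 2 * Real.pi * I / 3 * I_sq
  have q3 : exp (2 * Real.pi * I * (I * (1 - I) / 3)) = ω * w := by
    rw [hωdef, hw, ← exp_add]
    congr 1
    linear_combination -2 * Real.pi * I / 3 * I_sq
  have q4 : exp (2 * Real.pi * I * (3 * I)) = (Real.exp (-6 * Real.pi) : ℝ) := by
    rw [exp_quot_periodic 3 0 (by push_cast; ring)]
    congr 2; ring
  have q5 : exp (2 * Real.pi * I * (3 * (1 + I) / 2)) = ((-Real.exp (-3 * Real.pi) : ℝ) : ℂ) := by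
    rw [exp_quot_half (3 / 2) 1 (by push_cast; ring)]
    congr 3; ring
  have q6 : exp (2 * Real.pi * I * (3 * (I - 1) / 2)) = ((-Real.exp (-3 * Real.pi) : ℝ) : ℂ) := by
    rw [exp_quot_half (3 / 2) (-2) (by push_cast; ring)]
    congr 3; ring
  have hw1 : ‖w‖ < 1 := by
    rw [hw', norm_real, Real.norm_eq_abs, Real.abs_exp, Real.exp_lt_one_iff]
    linarith [Real.pi_pos]
  have hH := oddLambert_cube_roots hw1 hω (2 * k)
  rw [show w ^ 3 = (Real.exp (-2 * Real.pi) : ℝ) by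
      rw [hw']; exact ofReal_exp_pow (by push_cast; ring),
    show w ^ 9 = (Real.exp (-6 * Real.pi) : ℝ) by
      rw [hw']; exact ofReal_exp_pow (by push_cast; ring),
    show 2 * (2 * k) + 1 = 4 * k + 1 by ring] at hH
  rw [completedLambert_eq _ hw.symm, completedLambert_eq _ q4, one_pow,
    show 2 * (2 * k) + 1 = 4 * k + 1 by ring] at hA
  rw [completedLambert_eq _ q2, completedLambert_eq _ q5,
    show 2 * (2 * k) + 1 = 4 * k + 1 by ring] at hB
  rw [completedLambert_eq _ q3, completedLambert_eq _ q6,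
    show 2 * (2 * k) + 1 = 4 * k + 1 by ring] at hC
  have h2 : (3 : ℂ) ^ (4 * k) * (3 / 3 ^ (4 * k + 1)) = 1 := by
    rw [pow_succ]; field_simp
  have hI : ∀ e : ℤ, ∑ n ∈ Finset.Icc (-1 : ℤ) 1, (1 + I * (n : ℂ)) ^ e
      = 1 ^ e + (1 + I) ^ e + (1 - I) ^ e := by
    intro e
    rw [show Finset.Icc (-1 : ℤ) 1 = {-1, 0, 1} by decide]
    simp
    ring_nf
  have hS : ∀ j : ℕ, bernoulliPair (2 * k + 1) j * ((-1) ^ (j + 1)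
            * ((3 : ℂ) ^ (2 * (j : ℤ) - 1)
      * ∑ n ∈ Finset.Icc (-1 : ℤ) 1, (1 + I * (n : ℂ)) ^ (4 * (k : ℤ) + 1 - 2 * (j : ℤ))
    - (3 : ℂ) ^ (4 * (k : ℤ) + 1 - 2 * (j : ℤ))
      * ∑ n ∈ Finset.Icc (-1 : ℤ) 1, (1 + I * (n : ℂ)) ^ (2 * (j : ℤ) - 1)))
      = bernoulliPair (2 * k + 1) j * ((-1) ^ (j + 1)
            * (3 ^ (2 * (j : ℤ) - 1) * 1 ^ (4 * (k : ℤ) + 1 - 2 * (j : ℤ))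
              - 3 ^ (4 * (k : ℤ) + 1 - 2 * (j : ℤ)) * 1 ^ (2 * (j : ℤ) - 1)))
        + bernoulliPair (2 * k + 1) j * ((-1) ^ (j + 1)
            * (3 ^ (2 * (j : ℤ) - 1) * (1 + I) ^ (4 * (k : ℤ) + 1 - 2 * (j : ℤ))
              - 3 ^ (4 * (k : ℤ) + 1 - 2 * (j : ℤ)) * (1 + I) ^ (2 * (j : ℤ) - 1)))
        + bernoulliPair (2 * k + 1) j * ((-1) ^ (j + 1)
            * (3 ^ (2 * (j : ℤ) - 1) * (1 - I) ^ (4 * (k : ℤ) + 1 - 2 * (j : ℤ))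
              - 3 ^ (4 * (k : ℤ) + 1 - 2 * (j : ℤ)) * (1 - I) ^ (2 * (j : ℤ) - 1))) := by
    intro j
    rw [hI, hI]
    ring
  simp_rw [hS]
  rw [Finset.sum_add_distrib, Finset.sum_add_distrib]
  linear_combination hA + hB + hC + (-2 * 3 ^ (4 * k)) * hH
    - 2 * (oddLambert (2 * k) (Real.exp (-2 * Real.pi) : ℝ)
        - oddLambert (2 * k) (Real.exp (-6 * Real.pi) : ℝ)) * h2

/-! ### Nonvanishing of the denominator of a_k and of b_k -/

lemma aDen_pos (k : ℕ) : 0 < aDen k := by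
  have e : aDen k = 2 * ((2 : ℝ) ^ (2 * k)) ^ 2 - (-1) ^ k * 2 ^ (2 * k) + 1 := by
    rw [aDen]; ring
  rw [e]
  generalize (2 : ℝ) ^ (2 * k) = x
  rcases neg_one_pow_eq_or ℝ k with h | h <;> rw [h] <;>
    nlinarith [sq_nonneg x, sq_nonneg (x - 1), sq_nonneg (x + 1)]

lemma b_eq (k : ℕ) :
    b k = (3 ^ (4 * k + 1) + 1 - (1 + (-1) ^ k * 2 ^ (2 * k)) * aDen k) / aDen k := by
  have h := (aDen_pos k).ne'
  have e : (2 : ℝ) ^ (4 * k + 1) - (-1) ^ k * 2 ^ (2 * k) - 1 = aDen k - 2 := by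
    rw [aDen]; ring
  rw [b, a, e, pow_succ (2 : ℝ) (4 * k)]
  field_simp
  ring

lemma b_ne_zero {k : ℕ} (hk : 1 ≤ k) : b k ≠ 0 := by
  rw [b_eq]
  refine div_ne_zero (ne_of_gt ?_) (aDen_pos k).ne'
  have e : aDen k = 2 * ((2 : ℝ) ^ (2 * k)) ^ 2 - (-1) ^ k * 2 ^ (2 * k) + 1 := by
    rw [aDen]; ring
  -- This is 64^k ≤ 81^k.
  have h3 : ((2 : ℝ) ^ (2 * k)) ^ 3 ≤ 3 ^ (4 * k) := by
    rw [← pow_mul, show 2 * k * 3 = 6 * k by ring, pow_mul, pow_mul]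
    exact pow_le_pow_left₀ (by norm_num) (by norm_num) k
  have h1 : (1 : ℝ) < 2 ^ (2 * k) := one_lt_pow₀ (by norm_num) (by omega)
  rw [e, pow_succ (3 : ℝ)]
  generalize (2 : ℝ) ^ (2 * k) = x at *
  have hx : x ^ 2 < x ^ 3 := pow_lt_pow_right₀ h1 (by norm_num)
  -- With ε = (-1)^k the numerator expands to 3·3^(4k) - x² - 2εx³, which is at least x³ - x² in the
  -- worse case ε = 1.
  rcases neg_one_pow_eq_or ℝ k with h | h <;> rw [h]
  · nlinarith
  · have : 0 < x ^ 2 := by positivity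
    nlinarith

end LambertZeta

/-! ### Elimination of the series at e^(-2π) -/

theorem mainTheorem5 (k : ℕ) (hk : 1 ≤ k) :
    LambertZeta.aDen k ≠ 0 ∧ LambertZeta.b k ≠ 0 ∧
    Summable (fun n : ℕ => LambertZeta.lambertTerm
      (((-Real.exp (-3 * Real.pi)) : ℝ) : ℂ) (-4 * (k : ℂ) - 1) (n + 1)) ∧
    Summable (fun n : ℕ => LambertZeta.lambertTerm
      ((Real.exp (-4 * Real.pi) : ℝ) : ℂ) (-4 * (k : ℂ) - 1) (n + 1)) ∧
    Summable (fun n : ℕ => LambertZeta.lambertTerm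
      ((Real.exp (-6 * Real.pi) : ℝ) : ℂ) (-4 * (k : ℂ) - 1) (n + 1)) ∧
    riemannZeta (4 * (k : ℂ) + 1) =
      (2 * (Real.pi : ℂ)) ^ (4 * k + 1) / (2 * (LambertZeta.b k : ℂ))
          * ∑ j ∈ Finset.range (k + 1),
              (-1 : ℂ) ^ (j + 1) * LambertZeta.c j k
                * ((bernoulli (2 * j) : ℚ) : ℂ) * ((bernoulli (4 * k + 2 - 2 * j) : ℚ) : ℂ)
                / ((Nat.factorial (2 * j) : ℂ) * (Nat.factorial (4 * k + 2 - 2 * j) : ℂ))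
        + (-1 : ℂ) ^ k * 2 ^ (2 * k + 1) / (LambertZeta.b k : ℂ)
            * LambertZeta.lambertL (((-Real.exp (-3 * Real.pi)) : ℝ) : ℂ) (-4 * (k : ℂ) - 1)
        - (LambertZeta.a k : ℂ) / (2 ^ (4 * k - 1) * (LambertZeta.b k : ℂ))
            * LambertZeta.lambertL ((Real.exp (-4 * Real.pi) : ℝ) : ℂ) (-4 * (k : ℂ) - 1)
        + 2 ^ (2 * k) / (2 ^ (2 * k - 1) * (LambertZeta.b k : ℂ))
            * LambertZeta.lambertL ((Real.exp (-6 * Real.pi) : ℝ) : ℂ) (-4 * (k : ℂ) - 1) := by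

  have hpi := Real.pi_pos
  have hn3 : ‖((-Real.exp (-3 * Real.pi) : ℝ) : ℂ)‖ < 1 := by
    rw [Complex.norm_real, norm_neg, Real.norm_eq_abs, Real.abs_exp, Real.exp_lt_one_iff]
    linarith
  have hn4 : ‖((Real.exp (-4 * Real.pi) : ℝ) : ℂ)‖ < 1 := by
    rw [Complex.norm_real, Real.norm_eq_abs, Real.abs_exp, Real.exp_lt_one_iff]
    linarith
  have hn6 : ‖((Real.exp (-6 * Real.pi) : ℝ) : ℂ)‖ < 1 := by
    rw [Complex.norm_real, Real.norm_eq_abs, Real.abs_exp, Real.exp_lt_one_iff]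
    linarith
  have hD := (LambertZeta.aDen_pos k).ne'
  have hb := LambertZeta.b_ne_zero hk
  refine ⟨hD, hb, LambertZeta.summable_lambertTerm hn3 k, LambertZeta.summable_lambertTerm hn4 k,
    LambertZeta.summable_lambertTerm hn6 k, ?_⟩
  have hbC : (LambertZeta.b k : ℂ) ≠ 0 := Complex.ofReal_ne_zero.2 hb
  have h2 := LambertZeta.relation_two hk
  have h3 := LambertZeta.relation_three hk
  rw [LambertZeta.lambertL_eq_oddLambert, LambertZeta.lambertL_eq_oddLambert,
    LambertZeta.lambertL_eq_oddLambert,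
    show 4 * (k : ℂ) + 1 = (4 * k + 1 : ℕ) by push_cast; rfl]
  have hsum : ∑ j ∈ Finset.range (k + 1),
      (-1 : ℂ) ^ (j + 1) * LambertZeta.c j k
        * ((bernoulli (2 * j) : ℚ) : ℂ) * ((bernoulli (4 * k + 2 - 2 * j) : ℚ) : ℂ)
        / ((Nat.factorial (2 * j) : ℂ) * (Nat.factorial (4 * k + 2 - 2 * j) : ℂ))
      = ∑ j ∈ Finset.range (k + 1), LambertZeta.bernoulliPair (2 * k + 1) j * ((-1) ^ (j + 1)
            * ((3 : ℂ) ^ (2 * (j : ℤ) - 1)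
          * ∑ n ∈ Finset.Icc (-1 : ℤ) 1,
            (1 + Complex.I * (n : ℂ)) ^ (4 * (k : ℤ) + 1 - 2 * (j : ℤ))
        - (3 : ℂ) ^ (4 * (k : ℤ) + 1 - 2 * (j : ℤ))
          * ∑ n ∈ Finset.Icc (-1 : ℤ) 1, (1 + Complex.I * (n : ℂ)) ^ (2 * (j : ℤ) - 1)))
        - (LambertZeta.a k : ℂ) / 2 ^ (4 * k) * ∑ j ∈ Finset.range (k + 1),
          LambertZeta.bernoulliPair (2 * k + 1) j * ((-1) ^ (j + 1)
            * (2 ^ (2 * (j : ℤ) - 1) * (1 + (1 + Complex.I) ^ (4 * (k : ℤ) + 1 - 2 * (j : ℤ)))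
              - 2 ^ (4 * (k : ℤ) + 1 - 2 * (j : ℤ))
                * (1 + (1 + Complex.I) ^ (2 * (j : ℤ) - 1)))) := by
    rw [Finset.mul_sum, ← Finset.sum_sub_distrib]
    apply Finset.sum_congr rfl
    intro j _
    -- The two denominators in the bracket of c_jk multiply to 2^(4k), so the bracket is the summand
    -- of `relation_two` divided by 2^(4k), up to the sign and the Bernoulli factor.
    have hp : (2 : ℂ) ^ (2 * (j : ℤ) - 1) * 2 ^ (4 * (k : ℤ) + 1 - 2 * (j : ℤ))
        = 2 ^ (4 * k) := by
      rw [← zpow_add₀ two_ne_zero, ← zpow_natCast (2 : ℂ) (4 * k)]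
      congr 1
      push_cast
      ring
    have hf : (2 : ℂ) ^ (2 * (j : ℤ) - 1) ≠ 0 := zpow_ne_zero _ two_ne_zero
    have he : (2 : ℂ) ^ (4 * (k : ℤ) + 1 - 2 * (j : ℤ)) ≠ 0 := zpow_ne_zero _ two_ne_zero
    rw [LambertZeta.c, LambertZeta.bernoulliPair, show 2 * (2 * k + 1) = 4 * k + 2 by ring, ← hp]
    generalize (2 : ℂ) ^ (2 * (j : ℤ) - 1) = P at *
    generalize (2 : ℂ) ^ (4 * (k : ℤ) + 1 - 2 * (j : ℤ)) = R at *
    field_simp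
  rw [hsum]
  have hDC : (2 : ℂ) ^ (4 * k + 1) - (-1) ^ k * 2 ^ (2 * k) + 1 ≠ 0 := by
    have := Complex.ofReal_ne_zero.2 hD
    rw [LambertZeta.aDen] at this
    push_cast at this
    exact this
  have ha : (LambertZeta.a k : ℂ) * ((2 : ℂ) ^ (4 * k + 1) - (-1) ^ k * 2 ^ (2 * k) + 1)
      = 2 ^ (4 * k) * (3 ^ (4 * k + 1) + 1) := by
    rw [LambertZeta.a, LambertZeta.aDen]
    push_cast
    field_simp
  have hbdef : (LambertZeta.b k : ℂ) = (3 ^ (4 * k + 1) - 1) / 2 - (-1) ^ k * 2 ^ (2 * k)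
      - (LambertZeta.a k : ℂ)
        * ((2 ^ (4 * k + 1) - (-1) ^ k * 2 ^ (2 * k) - 1) / 2 ^ (4 * k + 1)) := by
    rw [LambertZeta.b]
    push_cast
    ring
  -- As k ≥ 1, the truncated subtractions in the exponents are genuine.
  have p1 : (2 : ℂ) ^ (4 * k) = 2 * 2 ^ (4 * k - 1) := by
    rw [← pow_succ']; congr 1; omega
  have p2 : (2 : ℂ) ^ (2 * k) = 2 * 2 ^ (2 * k - 1) := by
    rw [← pow_succ']; congr 1; omega
  have hx : (2 : ℂ) ^ (4 * k - 1) ≠ 0 := pow_ne_zero _ two_ne_zero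
  have hy : (2 : ℂ) ^ (2 * k - 1) ≠ 0 := pow_ne_zero _ two_ne_zero
  have hb2 : 2 * 2 ^ (4 * k) * (LambertZeta.b k : ℂ)
      = 2 ^ (4 * k) * (3 ^ (4 * k + 1) - 1) - 2 * 2 ^ (4 * k) * ((-1) ^ k * 2 ^ (2 * k))
        - (LambertZeta.a k : ℂ) * (2 ^ (4 * k + 1) - (-1) ^ k * 2 ^ (2 * k) - 1) := by
    rw [hbdef, pow_succ (2 : ℂ) (4 * k)]
    field_simp
  rw [pow_succ (2 : ℂ) (4 * k)] at ha hb2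
  rw [pow_succ (2 : ℂ) (2 * k)]
  rw [pow_succ (3 : ℂ) (4 * k)] at ha hb2
  generalize (2 * Real.pi : ℂ) ^ (4 * k + 1) = T at *
  generalize (Finset.sum (Finset.range (k + 1)) _ : ℂ) = S₃ at h3 ⊢
  generalize (Finset.sum (Finset.range (k + 1)) _ : ℂ) = S₂ at h2 ⊢
  generalize (3 : ℂ) ^ (4 * k) = N at *
  generalize (2 : ℂ) ^ (4 * k - 1) = x at *
  generalize (2 : ℂ) ^ (2 * k - 1) = y at *
  rw [p1, p2] at h2 ha hb2
  rw [p2] at h3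
  rw [p1, p2]
  generalize (LambertZeta.b k : ℂ) = β at *
  generalize (LambertZeta.a k : ℂ) = α at *
  generalize riemannZeta (4 * k + 1 : ℕ) = Z at *
  generalize (-1 : ℂ) ^ k = ε at *
  generalize LambertZeta.oddLambert (2 * k) (Real.exp (-2 * Real.pi) : ℝ) = L₂ at *
  generalize LambertZeta.oddLambert (2 * k) ((-Real.exp (-3 * Real.pi) : ℝ) : ℂ) = L₃ at *
  generalize LambertZeta.oddLambert (2 * k) (Real.exp (-4 * Real.pi) : ℝ) = L₄ at *
  generalize LambertZeta.oddLambert (2 * k) (Real.exp (-6 * Real.pi) : ℝ) = L₆ at *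
  field_simp
  -- Here 2x = 2^(4k). The defining equation `ha` of a_k cancels the series at e^(-2π), and `hb2`
  -- collects the coefficient of ζ(4k+1).
  linear_combination 2 * x * h3 - α * h2 + Z * hb2 + 2 * L₂ * ha
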